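/- Theorem 2.2. Let $P_1,\dots,P_n$ be mutually independent random variables, $P_i$ taking values in a measurable space $\Omega_i$ with distribution $\mu_i$, and let $\Pr=\mu_1\otimes\cdots\otimes\mu_n$. An event is a measurable set $B\subseteq\prod_i\Omega_i$ of assignments; $\mathrm{vbl}(B)$ denotes the smallest subset of the variables that determines $B$. Let $\mathcal A$ be a finite set of (bad) events, and for any event $B$ (in $\mathcal A$ or not) let $$\Gamma(B)=\{A\in\mathcal A : A\neq B,\ \mathrm{vbl}(A)\cap\mathrm{vbl}(B)\neq\emptyset\}.$$ The Moser–Tardos (MT) algorithm on $\mathcal A$ first samples all $P_i$ independently from their distributions; then, while some event of $\mathcal A$ is true under the current assignment, it picks a currently true $A\in\mathcal A$ and replaces the values of the variables in $\mathrm{vbl}(A)$ by fresh independent samples from their distributions. The rule for picking $A$ is arbitrary: it may depend measurably on all assignments seen so far and on random bits that are independent of all samples. Suppose that there is an assignment of reals $x:\mathcal A\to(0,1)$, $C\mapsto x_C$, such that $$\forall A\in\mathcal A:\qquad \Pr[A]\le x_A\prod_{C\in\Gamma(A)}(1-x_C).$$ Then, for every such picking rule, the MT algorithm stops almost surely, so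 that its output distribution is well defined, and for every event $B$ the probability that $B$ is true at least once during the execution of the algorithm (that is, under the initial assignment or under the assignment after some resampling step) is at most $$\Pr[B]\cdot\Bigl(\prod_{C\in\Gamma(B)}(1-x_C)\Bigr)^{-1}.$$ In particular, the probability that $B$ is true under the output of the algorithm is at most this same bound. -/

import Mathlib

open MeasureTheory

noncomputable section

namespace MoserTardos

universe u v w

variable {ι : Type u} {Ω : ι → Type v}

/-- The variables of an event `B`: the smallest set of variables that determines `B`. An event is a
set of assignments, and a set `S` of variables determines it if two assignments that agree
on `S` are both in `B` or both outside `B`. -/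
def vbl (B : Set (∀ i, Ω i)) : Set ι :=
  ⋂₀ {S : Set ι | DependsOn (fun a : ∀ i, Ω i => a ∈ B) S}

theorem dependsOn_inter {B : Set (∀ i, Ω i)} {S T : Set ι}
    (hS : DependsOn (fun a : ∀ i, Ω i => a ∈ B) S)
    (hT : DependsOn (fun a : ∀ i, Ω i => a ∈ B) T) :
    DependsOn (fun a : ∀ i, Ω i => a ∈ B) (S ∩ T) := by
  classical
  intro a b hab
  have h1 : (a ∈ B) = ((fun i => if i ∈ S then a i else b i) ∈ B) :=
    hS (fun i hi => by simp [hi])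
  have h2 : ((fun i => if i ∈ S then a i else b i) ∈ B) = (b ∈ B) := by
    refine hT (fun i hi => ?_)
    by_cases h : i ∈ S
    · simpa [h] using hab i ⟨h, hi⟩
    · simp [h]
  exact h1.trans h2

/-- With finitely many variables, `vbl B` does determine `B`, so it is the smallest such set. -/
theorem dependsOn_vbl [Finite ι] (B : Set (∀ i, Ω i)) :
    DependsOn (fun a : ∀ i, Ω i => a ∈ B) (vbl B) := by
  have key : ∀ F : Set (Set ι), F.Finite →
      (∀ S ∈ F, DependsOn (fun a : ∀ i, Ω i => a ∈ B) S) →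
      DependsOn (fun a : ∀ i, Ω i => a ∈ B) (⋂₀ F) := by
    intro F hF
    induction F, hF using Set.Finite.induction_on with
    | empty =>
      intro _ a b hab
      have : a = b := funext fun i => hab i (by simp)
      rw [this]
    | insert _ _ ih =>
      intro h
      rw [Set.sInter_insert]
      exact dependsOn_inter (h _ (Set.mem_insert _ _))
        (ih fun S hS => h S (Set.mem_insert_of_mem _ hS))
  exact key _ (Set.toFinite _) fun S hS => hS

theorem vbl_subset {B : Set (∀ i, Ω i)} {S : Set ι}
    (hS : DependsOn (fun a : ∀ i, Ω i => a ∈ B) S) : vbl B ⊆ S :=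
  Set.sInter_subset_of_mem hS

open Classical in
/-- `Γ(B)`: the events `A ≠ B` of the collection `𝒜` that share a variable with `B`. The event `B`
need not belong to `𝒜`. -/
def nbhd (𝒜 : Finset (Set (∀ i, Ω i))) (B : Set (∀ i, Ω i)) : Finset (Set (∀ i, Ω i)) :=
  {A ∈ 𝒜 | A ≠ B ∧ (vbl A ∩ vbl B).Nonempty}

variable [∀ i, MeasurableSpace (Ω i)]

/-- An arbitrary rule by which the algorithm picks, after `t` resamplings, a bad event that is
currently true. The rule sees all assignments `h 0, …, h t` up to now, and it may be randomized:
`seed` stands for its own random bits. It returns `none` exactly when no bad event is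
currently true, in which case the algorithm stops. -/
structure SelectionRule (𝒜 : Finset (Set (∀ i, Ω i))) (Seed : Type w) [MeasurableSpace Seed] where
  pick : Seed → (t : ℕ) → (Fin (t + 1) → ∀ i, Ω i) → Option 𝒜
  pick_some : ∀ (seed : Seed) (t : ℕ) (h : Fin (t + 1) → ∀ i, Ω i) (A : 𝒜),
    pick seed t h = some A → h (Fin.last t) ∈ (A : Set (∀ i, Ω i))
  pick_none : ∀ (seed : Seed) (t : ℕ) (h : Fin (t + 1) → ∀ i, Ω i),
    pick seed t h = none → ∀ A ∈ 𝒜, h (Fin.last t) ∉ A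
  measurableSet_pick : ∀ (t : ℕ) (o : Option 𝒜),
    MeasurableSet {p : Seed × (Fin (t + 1) → ∀ i, Ω i) | pick p.1 t p.2 = o}

variable {𝒜 : Finset (Set (∀ i, Ω i))} {Seed : Type w} [MeasurableSpace Seed]

/-- The randomness of a run: the random bits `ω.1` of the selection rule, and for every variable `i`
a stream `ω.2 (i, 0), ω.2 (i, 1), …` of draws; `ω.2 (i, k)` is the value that the variable `i`
receives when it is resampled for the `k`-th time (its initial value if `k = 0`). -/
abbrev Sample (Ω : ι → Type v) (Seed : Type w) : Type (max u v w) :=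
  Seed × (∀ p : ι × ℕ, Ω p.1)

/-- All draws are independent of each other and of the random bits of the selection rule, and
every draw of the variable `i` has the distribution `μ i` of that variable. -/
def runMeasure (μ : ∀ i, Measure (Ω i)) [∀ i, IsProbabilityMeasure (μ i)] (ν : Measure Seed) :
    Measure (Sample Ω Seed) :=
  ν.prod (Measure.infinitePi fun p : ι × ℕ => μ p.1)

open Classical in
/-- The first `t` steps of a run: the assignments at the times `0, …, t`, and for every variable the
number of times it has been resampled. While a bad event is true, one such event `A` is picked,
and precisely the variables of `A` receive fresh draws. After the algorithm has stopped, the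
assignment does not change any more. -/
def history (rule : SelectionRule 𝒜 Seed) (ω : Sample Ω Seed) :
    (t : ℕ) → (Fin (t + 1) → ∀ i, Ω i) × (ι → ℕ)
  | 0 => (fun _ i => ω.2 (i, 0), fun _ => 0)
  | t + 1 =>
    let h := (history rule ω t).1
    let k := (history rule ω t).2
    match rule.pick ω.1 t h with
    | none => (Fin.snoc (α := fun _ => ∀ i, Ω i) h (h (Fin.last t)), k)
    | some A =>
      (Fin.snoc (α := fun _ => ∀ i, Ω i) h
          (fun i => if i ∈ vbl (A : Set (∀ i, Ω i)) then ω.2 (i, k i + 1) else h (Fin.last t) i),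
        fun i => if i ∈ vbl (A : Set (∀ i, Ω i)) then k i + 1 else k i)

/-- The assignment at time `t` (after `t` resamplings, or the final one if the algorithm has
stopped earlier). -/
def assignment (rule : SelectionRule 𝒜 Seed) (ω : Sample Ω Seed) (t : ℕ) : ∀ i, Ω i :=
  (history rule ω t).1 (Fin.last t)

/-- The algorithm has stopped by time `t`: no bad event is true any more. -/
def StoppedAt (rule : SelectionRule 𝒜 Seed) (ω : Sample Ω Seed) (t : ℕ) : Prop :=
  rule.pick ω.1 t (history rule ω t).1 = none

open Classical in
/-- The output of the run: the assignment at which it stops, `none` if it runs forever. -/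
def output (rule : SelectionRule 𝒜 Seed) (ω : Sample Ω Seed) : Option (∀ i, Ω i) :=
  if h : ∃ t, StoppedAt rule ω t then some (assignment rule ω (Nat.find h)) else none

end MoserTardos

end

/-! Suppose that `B` is true at some time. Go backward through the run from there and collect every
resampled event that shares a variable with `B` or with an event collected before. Each collected
event joins the layer directly below the deepest layer in which it has such a relative. The events
of a layer have disjoint variables, and each layer lies in the closed neighborhood of the previous
one. Such lists of independent layers replace the witness trees of Moser and Tardos.

The numbers of earlier uses of a variable can be read off from the list, so the list determines
which draws made its layers true, and different layers use different draws. Hence a given list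
occurs with probability at most the product of the probabilities of its events. With
`1 + z C = (1 - x C)⁻¹`, the local lemma condition makes these products telescope: by induction on
the length, the lists whose first layer lies in `D` have total weight at most `∏ C ∈ D, (1 + z C)`.

At the first time `B` is true, `B` has not been resampled yet, so the first layer lies in `Γ(B)`;
this is the bound on hitting `B`. If `A` is resampled repeatedly, then different resamplings have
different lists. As the sum over all lists is finite, Borel-Cantelli shows that almost surely each
`A` is resampled only finitely often, so the run stops.
-/

namespace MoserTardos

noncomputable section

open scoped ENNReal NNReal

section Layers

variable {ι : Type*} {Ω : ι → Type*}

/-- The draws of a run; `T (i, k)` is the `k`-th value in the stream of the variable `i`. -/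
abbrev Table (Ω : ι → Type*) := ∀ p : ι × ℕ, Ω p.1

/-- A finite set of events that are considered to happen at the same time. -/
abbrev Layer (Ω : ι → Type*) := Finset (Set (∀ i, Ω i))

/-- The assignment that gives to each variable `i` the entry number `c i` of its stream. -/
def read (T : Table Ω) (c : ι → ℕ) : ∀ i, Ω i :=
  fun i => T (i, c i)

/-- The dependency relation on events, made reflexive. -/
def Related (A C : Set (∀ i, Ω i)) : Prop :=
  A = C ∨ (vbl A ∩ vbl C).Nonempty

/-- The event `A` is related to a member of the layer `I`. -/
def MeetsLayer (A : Set (∀ i, Ω i)) (I : Layer Ω) : Prop :=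
  ∃ C ∈ I, Related A C

/-- The event `A` is related to a member of one of the layers of `L`. -/
def Meets (A : Set (∀ i, Ω i)) (L : List (Layer Ω)) : Prop :=
  ∃ I ∈ L, MeetsLayer A I

/-- The variables on which the events of a layer depend. -/
def layerVbl (I : Layer Ω) : Set ι :=
  ⋃ A ∈ I, vbl A

/-- The number of draws of each variable that are consumed when every layer of `L` is resampled
once. -/
def usage : List (Layer Ω) → ι → ℕ
  | [] => 0
  | I :: L => usage L + (layerVbl I).indicator 1

/-- All layers of `L` are true when they are resampled one after the other, starting from the
assignment `read T c`. Time runs from the tail of the list to its head. -/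
def Consistent (T : Table Ω) (c : ι → ℕ) : List (Layer Ω) → Prop
  | [] => True
  | I :: L => read T (c + usage L) ∈ ⋂ A ∈ I, A ∧ Consistent T c L

open scoped Classical in
/-- The list of layers obtained from `I :: L` by adding an event `A` that happened before all of
them: `A` joins the layer that directly precedes the earliest layer it is related to, and it is
dropped if there is no such layer. The head `I` never changes and is not part of the value. -/
def graft (A : Set (∀ i, Ω i)) : Layer Ω → List (Layer Ω) → List (Layer Ω)
  | I, [] => if MeetsLayer A I then [{A}] else []
  | I, J :: L =>
    if Meets A (J :: L) then J :: graft A J L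
    else if MeetsLayer A I then insert A J :: L else J :: L

open scoped Classical in
/-- The closed neighborhood of a layer in the dependency graph: its members and their neighbors
in `𝒜`. -/
def closedNbhd (𝒜 J : Layer Ω) : Layer Ω :=
  J.biUnion fun C => insert C (nbhd 𝒜 C)

/-- The lists of nonempty independent layers in which the head is contained in `D`, and each further
layer in the closed neighborhood of the one before it in the list. These lists play the role of
the witness trees of Moser and Tardos. -/
def IsLayering (𝒜 : Layer Ω) : Layer Ω → List (Layer Ω) → Prop
  | _, [] => True
  | D, J :: L => J ⊆ D ∧ J.Nonempty ∧ (J : Set (Set (∀ i, Ω i))).PairwiseDisjoint vbl ∧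
      IsLayering 𝒜 (closedNbhd 𝒜 J) L

variable {𝒜 I J D D' : Layer Ω} {A B : Set (∀ i, Ω i)} {L : List (Layer Ω)} {i : ι}

theorem not_meets_nil : ¬ Meets A [] := by
  simp [Meets]

theorem meets_cons : Meets A (I :: L) ↔ MeetsLayer A I ∨ Meets A L := by
  simp [Meets]

theorem mem_nbhd : A ∈ nbhd 𝒜 B ↔ A ∈ 𝒜 ∧ A ≠ B ∧ (vbl A ∩ vbl B).Nonempty := by
  classical
  simp [nbhd]

theorem nbhd_subset : nbhd 𝒜 B ⊆ 𝒜 :=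
  fun _ hA => (mem_nbhd.1 hA).1

theorem closedNbhd_subset (hJ : J ⊆ 𝒜) : closedNbhd 𝒜 J ⊆ 𝒜 := by
  classical
  exact Finset.biUnion_subset.2 fun C hC => Finset.insert_subset (hJ hC) nbhd_subset

theorem closedNbhd_mono (h : I ⊆ J) : closedNbhd 𝒜 I ⊆ closedNbhd 𝒜 J := by
  classical
  exact Finset.biUnion_subset_biUnion_of_subset_left _ h

theorem MeetsLayer.mem_closedNbhd (h : MeetsLayer A J) (hA : A ∈ 𝒜) : A ∈ closedNbhd 𝒜 J := by
  classical
  obtain ⟨C, hC, hAC⟩ := h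
  refine Finset.mem_biUnion.2 ⟨C, hC, Finset.mem_insert.2 ?_⟩
  by_cases heq : A = C
  · exact .inl heq
  · exact .inr (mem_nbhd.2 ⟨hA, heq, hAC.resolve_left heq⟩)

theorem disjoint_vbl_layerVbl (h : ¬ MeetsLayer A I) : Disjoint (vbl A) (layerVbl I) :=
  Set.disjoint_iUnion₂_right.2 fun C hC => Set.disjoint_iff_inter_eq_empty.2 <|
    Set.not_nonempty_iff_eq_empty.1 fun hne => h ⟨C, hC, .inr hne⟩

theorem layerVbl_singleton : layerVbl {A} = vbl A := by
  simp [layerVbl]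

theorem layerVbl_insert [DecidableEq (Set (∀ i, Ω i))] :
    layerVbl (insert A J) = vbl A ∪ layerVbl J := by
  simp [layerVbl]

theorem usage_eq_zero_of_not_meets (h : ¬ Meets A L) (hi : i ∈ vbl A) : usage L i = 0 := by
  induction L with
  | nil => rfl
  | cons I L ih =>
    rw [meets_cons, not_or] at h
    have hiI : i ∉ layerVbl I := Set.disjoint_left.1 (disjoint_vbl_layerVbl h.1) hi
    simp [usage, ih h.2, hiI]

theorem graft_of_not_meets (h : ¬ Meets A (I :: L)) : graft A I L = L := by
  rw [meets_cons, not_or] at h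
  cases L <;> simp [graft, h.1, h.2]

theorem usage_graft (h : Meets A (I :: L)) :
    usage (graft A I L) = usage L + (vbl A).indicator 1 := by
  classical
  induction L generalizing I with
  | nil =>
    have hI : MeetsLayer A I := (meets_cons.1 h).resolve_right not_meets_nil
    simp [graft, hI, usage, layerVbl_singleton]
  | cons J L ih =>
    by_cases hL : Meets A (J :: L)
    · simp only [graft, if_pos hL, usage, ih hL, add_right_comm]
    · have hI : MeetsLayer A I := (meets_cons.1 h).resolve_right hL
      have hJ : Disjoint (vbl A) (layerVbl J) :=
        disjoint_vbl_layerVbl fun hJ => hL (meets_cons.2 (.inl hJ))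
      have hunion : (vbl A ∪ layerVbl J).indicator (1 : ι → ℕ) =
          (vbl A).indicator 1 + (layerVbl J).indicator 1 :=
        Set.indicator_union_of_disjoint hJ 1
      rw [graft, if_neg hL, if_pos hI, usage, usage, layerVbl_insert, hunion, ← add_assoc,
        add_right_comm]

theorem usage_graft_apply (hi : i ∈ layerVbl I) :
    usage (graft A I L) i = usage L i + (vbl A).indicator 1 i := by
  by_cases h : Meets A (I :: L)
  · rw [usage_graft h, Pi.add_apply]
  · have hAI : Disjoint (vbl A) (layerVbl I) :=
      disjoint_vbl_layerVbl fun hI => h (meets_cons.2 (.inl hI))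
    simp [graft_of_not_meets h, Set.disjoint_right.1 hAI hi]

theorem IsLayering.mono (hD : D ⊆ D') (hL : IsLayering 𝒜 D L) : IsLayering 𝒜 D' L := by
  cases L with
  | nil => trivial
  | cons J L => exact ⟨hL.1.trans hD, hL.2⟩

theorem IsLayering.forall_mem (hL : IsLayering 𝒜 D L) (hD : D ⊆ 𝒜) :
    ∀ J ∈ L, J ⊆ 𝒜 ∧ (J : Set (Set (∀ i, Ω i))).PairwiseDisjoint vbl := by
  induction L generalizing D with
  | nil => simp
  | cons J L ih =>
    obtain ⟨hJD, -, hJ, hL⟩ := hL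
    exact List.forall_mem_cons.2 ⟨⟨hJD.trans hD, hJ⟩, ih hL (closedNbhd_subset (hJD.trans hD))⟩

theorem IsLayering.graft (hL : IsLayering 𝒜 D L) (hA : A ∈ 𝒜) (hAD : MeetsLayer A I → A ∈ D) :
    IsLayering 𝒜 D (graft A I L) := by
  classical
  induction L generalizing D I with
  | nil =>
    rw [MoserTardos.graft]
    split_ifs with hI
    · exact ⟨by simpa using hAD hI, by simp, by simp, trivial⟩
    · trivial
  | cons J L ih =>
    obtain ⟨hJD, hJne, hJ, hL'⟩ := hL
    rw [MoserTardos.graft]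
    split_ifs with hmeets hI
    · exact ⟨hJD, hJne, hJ, ih hL' fun h => h.mem_closedNbhd hA⟩
    · have hAJ : Disjoint (vbl A) (layerVbl J) :=
        disjoint_vbl_layerVbl fun h => hmeets (meets_cons.2 (.inl h))
      refine ⟨Finset.insert_subset (hAD hI) hJD, Finset.insert_nonempty _ _, ?_,
        hL'.mono (closedNbhd_mono (Finset.subset_insert _ _))⟩
      rw [Finset.coe_insert]
      exact hJ.insert fun C hC _ => hAJ.mono_right (Set.subset_biUnion_of_mem hC)
    · exact ⟨hJD, hJne, hJ, hL'⟩

variable {T : Table Ω} {c c' : ι → ℕ}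

theorem read_apply_congr (h : c i = c' i) : read T c i = read T c' i :=
  congrArg (β := Ω i) (fun k => T (i, k)) h

variable [Finite ι]

theorem mem_iff_of_eqOn_vbl {a b : ∀ i, Ω i} (h : ∀ i ∈ vbl A, a i = b i) : a ∈ A ↔ b ∈ A :=
  iff_of_eq (dependsOn_vbl A h)

theorem dependsOn_biInter_layer (I : Layer Ω) :
    DependsOn (fun a : ∀ i, Ω i => a ∈ ⋂ A ∈ I, A) (layerVbl I) := by
  intro a b h
  simp only [Set.mem_iInter, eq_iff_iff]
  exact forall₂_congr fun C hC => mem_iff_of_eqOn_vbl fun i hi => h i (Set.mem_biUnion hC hi)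

theorem consistent_add_indicator_iff (h : ¬ Meets A L) :
    Consistent T (c + (vbl A).indicator 1) L ↔ Consistent T c L := by
  induction L with
  | nil => rfl
  | cons I L ih =>
    rw [meets_cons, not_or] at h
    refine and_congr (iff_of_eq (dependsOn_biInter_layer I fun i hi =>
      read_apply_congr ?_)) (ih h.2)
    simp [Set.disjoint_right.1 (disjoint_vbl_layerVbl h.1) hi]

theorem Consistent.graft_of_meets (hL : Consistent T (c + (vbl A).indicator 1) L)
    (hA : read T c ∈ A) (h : Meets A (I :: L)) : Consistent T c (graft A I L) := by
  classical
  induction L generalizing I with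
  | nil =>
    have hI : MeetsLayer A I := (meets_cons.1 h).resolve_right not_meets_nil
    simpa [MoserTardos.graft, hI, Consistent, usage] using hA
  | cons J L ih =>
    by_cases hmeets : Meets A (J :: L)
    · rw [MoserTardos.graft, if_pos hmeets]
      refine ⟨?_, ih hL.2 hmeets⟩
      rw [usage_graft hmeets, ← add_assoc, add_right_comm]
      exact hL.1
    · have hI : MeetsLayer A I := (meets_cons.1 h).resolve_right hmeets
      have hJL : Consistent T c (J :: L) := (consistent_add_indicator_iff hmeets).1 hL
      have hAL : ∀ i ∈ vbl A, read T c i = read T (c + usage L) i := fun i hi =>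
        read_apply_congr <| by
          simp [usage_eq_zero_of_not_meets (fun hL => hmeets (meets_cons.2 (.inr hL))) hi]
      rw [MoserTardos.graft, if_neg hmeets, if_pos hI]
      refine ⟨?_, hJL.2⟩
      rw [Finset.set_biInter_insert]
      exact ⟨(mem_iff_of_eqOn_vbl hAL).1 hA, hJL.1⟩

theorem Consistent.graft (h : Consistent T (c + (vbl A).indicator 1) (I :: L))
    (hA : read T c ∈ A) : Consistent T c (I :: graft A I L) := by
  by_cases hmeets : Meets A (I :: L)
  · refine ⟨?_, h.2.graft_of_meets hA hmeets⟩
    rw [usage_graft hmeets, ← add_assoc, add_right_comm]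
    exact h.1
  · rw [graft_of_not_meets hmeets]
    exact (consistent_add_indicator_iff hmeets).1 h

theorem dependsOn_consistent (c : ι → ℕ) (L : List (Layer Ω)) :
    DependsOn (fun T : Table Ω => Consistent T c L) {p | p.2 < c p.1 + usage L p.1} := by
  induction L with
  | nil => exact fun _ _ _ => rfl
  | cons J L ih =>
    intro T T' h
    refine congrArg₂ And (dependsOn_biInter_layer J fun i hi => h (i, _) ?_)
      (ih fun p hp => h p ?_)
    · simp [usage, hi]
    · simp only [Set.mem_ofPred_eq, usage, Pi.add_apply] at hp ⊢
      omega

end Layers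

section Independence

open ProbabilityTheory

variable {κ : Type*} {X : κ → Type*} [∀ k, MeasurableSpace (X k)]

theorem measurableSet_iSup_comap_of_dependsOn [∀ k, Nonempty (X k)] {E : Set (∀ k, X k)}
    {s : Set κ} (hE : MeasurableSet E) (hEs : DependsOn (fun a : ∀ k, X k => a ∈ E) s) :
    MeasurableSet[⨆ k ∈ s, MeasurableSpace.comap (fun a : ∀ k, X k => a k) inferInstance] E := by
  classical
  let base : ∀ k, X k := fun _ => Classical.arbitrary _
  have hpre : (fun a : ∀ k, X k => s.piecewise a base) ⁻¹' E = E := Set.ext fun a =>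
    iff_of_eq (hEs fun k hk => Set.piecewise_eq_of_mem s a base hk)
  rw [← hpre]
  refine (@measurable_pi_iff _ _ _ (_) _ _).2 (fun k => ?_) hE
  by_cases hk : k ∈ s
  · simp only [Set.piecewise_eq_of_mem s _ _ hk]
    exact Measurable.of_comap_le (le_biSup (fun k => MeasurableSpace.comap
      (fun a : ∀ k, X k => a k) inferInstance) hk)
  · simp only [Set.piecewise_eq_of_notMem s _ _ hk]
    exact measurable_const

theorem infinitePi_inter_of_dependsOn (m : ∀ k, Measure (X k)) [∀ k, IsProbabilityMeasure (m k)]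
    {E F : Set (∀ k, X k)} {s t : Set κ} (hE : MeasurableSet E) (hF : MeasurableSet F)
    (hEs : DependsOn (fun a : ∀ k, X k => a ∈ E) s)
    (hFt : DependsOn (fun a : ∀ k, X k => a ∈ F) t) (hst : Disjoint s t) :
    Measure.infinitePi m (E ∩ F) = Measure.infinitePi m E * Measure.infinitePi m F := by
  have : ∀ k, Nonempty (X k) := fun k => nonempty_of_isProbabilityMeasure (m k)
  have hindep : iIndepFun (fun k (a : ∀ k, X k) => a k) (Measure.infinitePi m) :=
    iIndepFun_infinitePi (X := fun k (a : X k) => a) fun _ => measurable_id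
  exact (Indep_iff _ _ _).1
    (indep_iSup_of_disjoint (fun k => (measurable_pi_apply k).comap_le) hindep hst) E F
    (measurableSet_iSup_comap_of_dependsOn hE hEs) (measurableSet_iSup_comap_of_dependsOn hF hFt)

end Independence

section Weights

variable {ι : Type*} {Ω : ι → Type*} [∀ i, MeasurableSpace (Ω i)]

theorem measurable_read (c : ι → ℕ) : Measurable fun T : Table Ω => read T c :=
  measurable_pi_lambda _ fun i => measurable_pi_apply (i, c i)

theorem measurableSet_consistent (c : ι → ℕ) {L : List (Layer Ω)}
    (hL : ∀ J ∈ L, ∀ A ∈ J, MeasurableSet A) : MeasurableSet {T : Table Ω | Consistent T c L} := by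
  induction L with
  | nil => exact .univ
  | cons J L ih =>
    rw [List.forall_mem_cons] at hL
    exact (measurable_read _ (J.measurableSet_biInter hL.1)).inter (ih hL.2)

/-- The distribution of the table of draws: all entries are independent, and those of the stream of
the variable `i` have the distribution `μ i`. -/
abbrev tableMeasure (μ : ∀ i, Measure (Ω i)) [∀ i, IsProbabilityMeasure (μ i)] :
    Measure (Table Ω) :=
  Measure.infinitePi fun p : ι × ℕ => μ p.1

variable [Fintype ι] (μ : ∀ i, Measure (Ω i))

/-- The probability that all layers of `L` are true, when each of them is evaluated at fresh
draws. -/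
def weight (L : List (Layer Ω)) : ℝ≥0∞ :=
  (L.map fun J => ∏ A ∈ J, Measure.pi μ A).prod

theorem weight_nil : weight μ [] = 1 := rfl

theorem weight_cons (J : Layer Ω) (L : List (Layer Ω)) :
    weight μ (J :: L) = (∏ A ∈ J, Measure.pi μ A) * weight μ L := by
  simp [weight]

variable [∀ i, IsProbabilityMeasure (μ i)]

theorem pi_biInter_layer {J : Layer Ω} (hJ : ∀ A ∈ J, MeasurableSet A)
    (hdisj : (J : Set (Set (∀ i, Ω i))).PairwiseDisjoint vbl) :
    Measure.pi μ (⋂ A ∈ J, A) = ∏ A ∈ J, Measure.pi μ A := by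
  classical
  induction J using Finset.induction_on with
  | empty => simp
  | insert A J hA ih =>
    rw [Finset.forall_mem_insert] at hJ
    rw [Finset.coe_insert, Set.pairwiseDisjoint_insert_of_notMem (by simpa using hA)] at hdisj
    rw [Finset.set_biInter_insert, Finset.prod_insert hA, ← ih hJ.2 hdisj.1,
      ← Measure.infinitePi_eq_pi]
    exact infinitePi_inter_of_dependsOn μ hJ.1 (J.measurableSet_biInter hJ.2) (dependsOn_vbl A)
      (dependsOn_biInter_layer J) (Set.disjoint_iUnion₂_right.2 hdisj.2)

theorem map_read_tableMeasure (c : ι → ℕ) :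
    (tableMeasure μ).map (fun T => read T c) = Measure.pi μ := by
  have hinj : Function.Injective fun i => (i, c i) := fun i j h => (Prod.ext_iff.1 h).1
  rw [← Measure.infinitePi_eq_pi]
  exact Measure.map_infinitePi_infinitePi_of_inj (P := fun p : ι × ℕ => μ p.1) hinj

/-- The layers of `L` read disjoint parts of the table. -/
theorem tableMeasure_consistent (c : ι → ℕ) {L : List (Layer Ω)}
    (hL : ∀ J ∈ L, ∀ A ∈ J, MeasurableSet A)
    (hdisj : ∀ J ∈ L, (J : Set (Set (∀ i, Ω i))).PairwiseDisjoint vbl) :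
    tableMeasure μ {T | Consistent T c L} = weight μ L := by
  induction L with
  | nil => simp [Consistent, weight_nil]
  | cons J L ih =>
    rw [List.forall_mem_cons] at hL hdisj
    have hread := measurable_read (Ω := Ω) (c + usage L)
    have hJ : MeasurableSet (⋂ A ∈ J, A) := J.measurableSet_biInter hL.1
    have hdep : DependsOn (fun T : Table Ω => T ∈ (read · (c + usage L)) ⁻¹' ⋂ A ∈ J, A)
        {p | p.2 = c p.1 + usage L p.1} := fun T T' h =>
      congrArg (· ∈ ⋂ A ∈ J, A) (funext fun i => h (i, c i + usage L i) rfl)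
    calc tableMeasure μ {T | Consistent T c (J :: L)}
        = tableMeasure μ ((read · (c + usage L)) ⁻¹' (⋂ A ∈ J, A) ∩ {T | Consistent T c L}) := rfl
      _ = tableMeasure μ ((read · (c + usage L)) ⁻¹' ⋂ A ∈ J, A) *
            tableMeasure μ {T | Consistent T c L} :=
          infinitePi_inter_of_dependsOn _ (hread hJ) (measurableSet_consistent c hL.2) hdep
            (dependsOn_consistent c L) (Set.disjoint_left.2 fun p hp hp' => hp'.ne hp)
      _ = (∏ A ∈ J, Measure.pi μ A) * weight μ L := by
          rw [← Measure.map_apply hread hJ, map_read_tableMeasure, pi_biInter_layer μ hL.1 hdisj.1,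
            ih hL.2 hdisj.2]
      _ = weight μ (J :: L) := (weight_cons μ J L).symm

end Weights

section Counting

theorem prod_biUnion_le_prod_prod {α β M : Type*} [DecidableEq β] [CommMonoid M] [PartialOrder M]
    [IsOrderedMonoid M] {s : Finset α} {t : α → Finset β} {f : β → M}
    (hf : ∀ a ∈ s, ∀ b ∈ t a, 1 ≤ f b) :
    ∏ b ∈ s.biUnion t, f b ≤ ∏ a ∈ s, ∏ b ∈ t a, f b := by
  classical
  induction s using Finset.induction_on with
  | empty => simp
  | insert a s ha ih =>
    rw [Finset.forall_mem_insert] at hf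
    rw [Finset.biUnion_insert, Finset.prod_insert ha]
    calc ∏ b ∈ t a ∪ s.biUnion t, f b
        ≤ (∏ b ∈ t a ∪ s.biUnion t, f b) * ∏ b ∈ t a ∩ s.biUnion t, f b :=
          le_mul_of_one_le_right' <|
            Finset.one_le_prod' fun b hb => hf.1 b (Finset.mem_inter.1 hb).1
      _ = (∏ b ∈ t a, f b) * ∏ b ∈ s.biUnion t, f b := Finset.prod_union_inter
      _ ≤ (∏ b ∈ t a, f b) * ∏ a ∈ s, ∏ b ∈ t a, f b := mul_le_mul_right (ih hf.2) _

variable {ι : Type*} {Ω : ι → Type*} {𝒜 : Layer Ω}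

open scoped Classical in
/-- The lists in `IsLayering 𝒜 D` of length at most `n`. -/
def layerings (𝒜 : Layer Ω) : ℕ → Layer Ω → Finset (List (Layer Ω))
  | 0, _ => {[]}
  | n + 1, D => insert [] (({J ∈ D.powerset.erase ∅ |
      (J : Set (Set (∀ i, Ω i))).PairwiseDisjoint vbl} : Finset (Layer Ω)).biUnion fun J =>
        (layerings 𝒜 n (closedNbhd 𝒜 J)).image (J :: ·))

theorem mem_layerings {n : ℕ} {D : Layer Ω} {L : List (Layer Ω)} :
    L ∈ layerings 𝒜 n D ↔ IsLayering 𝒜 D L ∧ L.length ≤ n := by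
  classical
  induction n generalizing D L with
  | zero => cases L <;> simp [layerings, IsLayering]
  | succ n ih =>
    cases L <;>
      simp [layerings, IsLayering, ih, Finset.nonempty_iff_ne_empty, and_assoc, and_left_comm]

theorem countable_isLayering (D : Layer Ω) : {L | IsLayering 𝒜 D L}.Countable :=
  (Set.countable_iUnion fun n => (layerings 𝒜 n D).countable_toSet).mono fun L hL =>
    Set.mem_iUnion.2 ⟨L.length, mem_layerings.2 ⟨hL, le_rfl⟩⟩

variable [Fintype ι] [∀ i, MeasurableSpace (Ω i)] {μ : ∀ i, Measure (Ω i)}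
  {z : Set (∀ i, Ω i) → ℝ≥0}

open scoped Classical in
/-- The hypothesis of the asymmetric local lemma, expressed in the odds `z A = x A / (1 - x A)`, for
which `1 + z A = (1 - x A)⁻¹`. -/
def LocalLemmaCondition (μ : ∀ i, Measure (Ω i)) (𝒜 : Layer Ω) (z : Set (∀ i, Ω i) → ℝ≥0) : Prop :=
  ∀ A ∈ 𝒜, Measure.pi μ A * ∏ C ∈ insert A (nbhd 𝒜 A), (1 + z C : ℝ≥0∞) ≤ z A

theorem LocalLemmaCondition.prod_measure_mul_prod_le (hz : LocalLemmaCondition μ 𝒜 z)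
    {J : Layer Ω} (hJ : J ⊆ 𝒜) :
    (∏ A ∈ J, Measure.pi μ A) * ∏ C ∈ closedNbhd 𝒜 J, (1 + z C : ℝ≥0∞) ≤ ∏ A ∈ J, (z A : ℝ≥0∞) := by
  classical
  calc (∏ A ∈ J, Measure.pi μ A) * ∏ C ∈ closedNbhd 𝒜 J, (1 + z C : ℝ≥0∞)
      ≤ (∏ A ∈ J, Measure.pi μ A) * ∏ A ∈ J, ∏ C ∈ insert A (nbhd 𝒜 A), (1 + z C : ℝ≥0∞) :=
        mul_le_mul_right (prod_biUnion_le_prod_prod fun _ _ _ _ => le_self_add) _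
    _ = ∏ A ∈ J, Measure.pi μ A * ∏ C ∈ insert A (nbhd 𝒜 A), (1 + z C : ℝ≥0∞) :=
        Finset.prod_mul_distrib.symm
    _ ≤ ∏ A ∈ J, (z A : ℝ≥0∞) := Finset.prod_le_prod' fun A hA => hz A (hJ hA)

theorem LocalLemmaCondition.sum_weight_layerings_le (hz : LocalLemmaCondition μ 𝒜 z) (n : ℕ)
    {D : Layer Ω} (hD : D ⊆ 𝒜) :
    ∑ L ∈ layerings 𝒜 n D, weight μ L ≤ ∏ C ∈ D, (1 + z C : ℝ≥0∞) := by
  classical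
  induction n generalizing D with
  | zero =>
    simpa [layerings, weight_nil] using Finset.one_le_prod' fun C _ => le_self_add
  | succ n ih =>
    have hlayer : ∀ J ∈ D.powerset.erase ∅,
        ∑ L ∈ (layerings 𝒜 n (closedNbhd 𝒜 J)).image (J :: ·), weight μ L ≤
          ∏ A ∈ J, (z A : ℝ≥0∞) := fun J hJ => by
      have hJ𝒜 : J ⊆ 𝒜 := (Finset.mem_powerset.1 (Finset.mem_of_mem_erase hJ)).trans hD
      rw [Finset.sum_image fun _ _ _ _ h => (List.cons.inj h).2]
      simp only [weight_cons, ← Finset.mul_sum]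
      exact (mul_le_mul_right (ih (closedNbhd_subset hJ𝒜)) _).trans
        (hz.prod_measure_mul_prod_le hJ𝒜)
    have hdisj : Set.univ.PairwiseDisjoint fun J : Layer Ω =>
        (layerings 𝒜 n (closedNbhd 𝒜 J)).image (J :: ·) := fun J _ K _ hJK => by
      refine Finset.disjoint_left.2 fun L hJ hK => hJK ?_
      obtain ⟨_, -, rfl⟩ := Finset.mem_image.1 hJ
      obtain ⟨_, -, h⟩ := Finset.mem_image.1 hK
      exact (List.cons.inj h).1.symm
    calc ∑ L ∈ layerings 𝒜 (n + 1) D, weight μ L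
        ≤ 1 + ∑ J ∈ D.powerset.erase ∅,
            ∑ L ∈ (layerings 𝒜 n (closedNbhd 𝒜 J)).image (J :: ·), weight μ L := by
          rw [layerings, Finset.sum_insert (by simp), weight_nil]
          gcongr
          rw [Finset.sum_biUnion (hdisj.subset (Set.subset_univ _))]
          exact Finset.sum_le_sum_of_subset (Finset.filter_subset _ _)
      _ ≤ 1 + ∑ J ∈ D.powerset.erase ∅, ∏ A ∈ J, (z A : ℝ≥0∞) := by
          gcongr with J hJ
          exact hlayer J hJ
      _ = ∑ J ∈ D.powerset, ∏ A ∈ J, (z A : ℝ≥0∞) := by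
          rw [← Finset.add_sum_erase _ _ (Finset.empty_mem_powerset D), Finset.prod_empty]
      _ = ∏ C ∈ D, (1 + z C : ℝ≥0∞) := (Finset.prod_one_add _).symm

theorem LocalLemmaCondition.tsum_weight_le (hz : LocalLemmaCondition μ 𝒜 z) {D : Layer Ω}
    (hD : D ⊆ 𝒜) :
    ∑' L : {L | IsLayering 𝒜 D L}, weight μ (L : List (Layer Ω)) ≤
      ∏ C ∈ D, (1 + z C : ℝ≥0∞) := by
  rw [ENNReal.tsum_eq_iSup_sum]
  refine iSup_le fun s => ?_
  calc ∑ L ∈ s, weight μ (L : List (Layer Ω))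
      = ∑ L ∈ s.map (Function.Embedding.subtype _), weight μ L :=
        (Finset.sum_map s (Function.Embedding.subtype _) (weight μ)).symm
    _ ≤ ∑ L ∈ layerings 𝒜 (s.sup fun L => L.1.length) D, weight μ L := by
        refine Finset.sum_le_sum_of_subset fun L hL => ?_
        obtain ⟨L, hLs, rfl⟩ := Finset.mem_map.1 hL
        exact mem_layerings.2 ⟨L.2, Finset.le_sup (f := fun L => L.1.length) hLs⟩
    _ ≤ ∏ C ∈ D, (1 + z C : ℝ≥0∞) := hz.sum_weight_layerings_le _ hD

end Counting

section Witnesses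

variable {ι : Type*} {Ω : ι → Type*} {𝒜 D : Layer Ω} {B : Set (∀ i, Ω i)}

/-- The layerings that may precede `B` in a run that starts at the assignment `read T c`: all their
layers, and finally `B`, are true when they are evaluated at the draws that they use up. -/
def witnesses (𝒜 D : Layer Ω) (B : Set (∀ i, Ω i)) (T : Table Ω) (c : ι → ℕ) :
    Set (List (Layer Ω)) :=
  {L | IsLayering 𝒜 D L ∧ Consistent T c ({B} :: L)}

variable [Fintype ι] [∀ i, MeasurableSpace (Ω i)] {μ : ∀ i, Measure (Ω i)}
  [∀ i, IsProbabilityMeasure (μ i)] {z : Set (∀ i, Ω i) → ℝ≥0}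

theorem tableMeasure_consistent_singleton_cons (h𝒜 : ∀ A ∈ 𝒜, MeasurableSet A)
    (hB : MeasurableSet B) (hD : D ⊆ 𝒜) {L : List (Layer Ω)} (hL : IsLayering 𝒜 D L) (c : ι → ℕ) :
    tableMeasure μ {T | Consistent T c ({B} :: L)} = Measure.pi μ B * weight μ L := by
  have hL := hL.forall_mem hD
  rw [tableMeasure_consistent, weight_cons, Finset.prod_singleton]
  · exact List.forall_mem_cons.2 ⟨by simpa using hB, fun J hJ A hA => h𝒜 A ((hL J hJ).1 hA)⟩
  · exact List.forall_mem_cons.2 ⟨by simp, fun J hJ => (hL J hJ).2⟩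

theorem LocalLemmaCondition.tsum_consistent_le (hz : LocalLemmaCondition μ 𝒜 z)
    (h𝒜 : ∀ A ∈ 𝒜, MeasurableSet A) (hB : MeasurableSet B) (hD : D ⊆ 𝒜) (c : ι → ℕ) :
    ∑' L : {L | IsLayering 𝒜 D L}, tableMeasure μ {T | Consistent T c ({B} :: (L : List _))} ≤
      Measure.pi μ B * ∏ C ∈ D, (1 + z C : ℝ≥0∞) := by
  rw [tsum_congr fun L : {L | IsLayering 𝒜 D L} =>
    tableMeasure_consistent_singleton_cons h𝒜 hB hD L.2 c, ENNReal.tsum_mul_left]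
  exact mul_le_mul_right (hz.tsum_weight_le hD) _

theorem LocalLemmaCondition.measure_witnesses_nonempty_le (hz : LocalLemmaCondition μ 𝒜 z)
    (h𝒜 : ∀ A ∈ 𝒜, MeasurableSet A) (hB : MeasurableSet B) (hD : D ⊆ 𝒜) (c : ι → ℕ) :
    tableMeasure μ {T | (witnesses 𝒜 D B T c).Nonempty} ≤
      Measure.pi μ B * ∏ C ∈ D, (1 + z C : ℝ≥0∞) :=
  calc tableMeasure μ {T | (witnesses 𝒜 D B T c).Nonempty}
      ≤ tableMeasure μ (⋃ L ∈ {L | IsLayering 𝒜 D L}, {T | Consistent T c ({B} :: L)}) :=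
        measure_mono fun _ ⟨_, hL, hT⟩ => Set.mem_biUnion hL hT
    _ ≤ _ := measure_biUnion_le _ (countable_isLayering D) _
    _ ≤ _ := hz.tsum_consistent_le h𝒜 hB hD c

theorem LocalLemmaCondition.ae_finite_witnesses (hz : LocalLemmaCondition μ 𝒜 z)
    (h𝒜 : ∀ A ∈ 𝒜, MeasurableSet A) (hB : MeasurableSet B) (hD : D ⊆ 𝒜) (c : ι → ℕ) :
    ∀ᵐ T ∂tableMeasure μ, (witnesses 𝒜 D B T c).Finite := by
  have : Countable {L | IsLayering 𝒜 D L} := (countable_isLayering D).to_subtype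
  have hfin : Measure.pi μ B * ∏ C ∈ D, (1 + z C : ℝ≥0∞) < ⊤ :=
    ENNReal.mul_lt_top (measure_lt_top _ _) <| ENNReal.prod_lt_top fun C _ => by simp
  filter_upwards [ae_finite_setOfPred_mem
    ((hz.tsum_consistent_le h𝒜 hB hD c).trans_lt hfin).ne] with T hT
  exact (hT.image Subtype.val).subset fun L hL => ⟨⟨L, hL.1⟩, hL.2, rfl⟩

/-- A true event without variables has probability `1`, and `1 + z A ≤ z A` is impossible. -/
theorem LocalLemmaCondition.vbl_nonempty (hz : LocalLemmaCondition μ 𝒜 z) {A : Set (∀ i, Ω i)}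
    (hA : A ∈ 𝒜) (hne : A.Nonempty) : (vbl A).Nonempty := by
  classical
  by_contra hvbl
  rw [Set.not_nonempty_iff_eq_empty] at hvbl
  obtain ⟨a, ha⟩ := hne
  have huniv : A = Set.univ :=
    Set.eq_univ_of_forall fun b => (mem_iff_of_eqOn_vbl (by simp [hvbl])).1 ha
  have hle : (1 + z A : ℝ≥0∞) ≤ z A :=
    calc (1 + z A : ℝ≥0∞)
        ≤ ∏ C ∈ insert A (nbhd 𝒜 A), (1 + z C : ℝ≥0∞) :=
          Finset.single_le_prod' (f := fun C => (1 + z C : ℝ≥0∞)) (fun _ _ => le_self_add)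
            (Finset.mem_insert_self _ _)
      _ = Measure.pi μ A * ∏ C ∈ insert A (nbhd 𝒜 A), (1 + z C : ℝ≥0∞) := by
          rw [huniv, measure_univ, one_mul]
      _ ≤ z A := hz A hA
  exact absurd hle (not_le.2 (by exact_mod_cast lt_one_add (z A)))

end Witnesses

section Run

variable {ι : Type*} {Ω : ι → Type*} [∀ i, MeasurableSpace (Ω i)] {𝒜 : Layer Ω}
  {Seed : Type*} [MeasurableSpace Seed] {rule : SelectionRule 𝒜 Seed} {ω : Sample Ω Seed}
  {s t : ℕ} {A : 𝒜} {B : Set (∀ i, Ω i)} {D : Layer Ω} {i : ι}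

/-- The number of times each variable has been resampled by time `t`. -/
def counts (rule : SelectionRule 𝒜 Seed) (ω : Sample Ω Seed) (t : ℕ) : ι → ℕ :=
  (history rule ω t).2

/-- The event picked at time `t` is `A`: the step from `t` to `t + 1` resamples `vbl A`. -/
def PickedAt (rule : SelectionRule 𝒜 Seed) (ω : Sample Ω Seed) (t : ℕ) (A : 𝒜) : Prop :=
  rule.pick ω.1 t (history rule ω t).1 = some A

theorem stoppedAt_or_exists_pickedAt (rule : SelectionRule 𝒜 Seed) (ω : Sample Ω Seed) (t : ℕ) :
    StoppedAt rule ω t ∨ ∃ A, PickedAt rule ω t A :=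
  Option.eq_none_or_eq_some _

theorem PickedAt.mem (h : PickedAt rule ω t A) : assignment rule ω t ∈ (A : Set (∀ i, Ω i)) :=
  rule.pick_some _ _ _ _ h

theorem StoppedAt.counts_succ (h : StoppedAt rule ω t) :
    counts rule ω (t + 1) = counts rule ω t := by
  rw [counts, history, show rule.pick ω.1 t (history rule ω t).1 = none from h]
  rfl

theorem StoppedAt.assignment_succ (h : StoppedAt rule ω t) :
    assignment rule ω (t + 1) = assignment rule ω t := by
  rw [assignment, history, show rule.pick ω.1 t (history rule ω t).1 = none from h]
  simp [assignment]

theorem PickedAt.counts_succ (h : PickedAt rule ω t A) :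
    counts rule ω (t + 1) = counts rule ω t + (vbl (A : Set (∀ i, Ω i))).indicator 1 := by
  classical
  rw [counts, history, show rule.pick ω.1 t (history rule ω t).1 = some A from h]
  funext i
  by_cases hi : i ∈ vbl (A : Set (∀ i, Ω i)) <;> simp [hi, counts]

open scoped Classical in
theorem PickedAt.assignment_succ (h : PickedAt rule ω t A) (i : ι) :
    assignment rule ω (t + 1) i =
      if i ∈ vbl (A : Set (∀ i, Ω i)) then ω.2 (i, counts rule ω t i + 1)
      else assignment rule ω t i := by
  rw [assignment, history, show rule.pick ω.1 t (history rule ω t).1 = some A from h]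
  simp [counts, assignment]

theorem assignment_eq_read (rule : SelectionRule 𝒜 Seed) (ω : Sample Ω Seed) (t : ℕ) :
    assignment rule ω t = read ω.2 (counts rule ω t) := by
  classical
  induction t with
  | zero => rfl
  | succ t ih =>
    obtain h | ⟨A, h⟩ := stoppedAt_or_exists_pickedAt rule ω t
    · rw [h.assignment_succ, h.counts_succ, ih]
    · funext i
      rw [h.assignment_succ, h.counts_succ, ih]
      split_ifs with hi
      · exact read_apply_congr (i := i) (c := counts rule ω t + 1) (by simp [hi])
      · exact read_apply_congr (by simp [hi])

theorem counts_mono (rule : SelectionRule 𝒜 Seed) (ω : Sample Ω Seed) :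
    Monotone (counts rule ω) := by
  refine monotone_nat_of_le_succ fun t => ?_
  obtain h | ⟨A, h⟩ := stoppedAt_or_exists_pickedAt rule ω t
  · exact h.counts_succ.ge
  · exact h.counts_succ ▸ le_self_add

theorem PickedAt.counts_lt (h : PickedAt rule ω t A) (hi : i ∈ vbl (A : Set (∀ i, Ω i)))
    (hts : t < s) : counts rule ω t i < counts rule ω s i :=
  calc counts rule ω t i < counts rule ω (t + 1) i := by simp [h.counts_succ, hi]
    _ ≤ counts rule ω s i := counts_mono rule ω hts i

theorem nil_mem_witnesses (h : assignment rule ω t ∈ B) :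
    [] ∈ witnesses 𝒜 D B ω.2 (counts rule ω t) := by
  rw [assignment_eq_read] at h
  simpa [witnesses, IsLayering, Consistent, usage] using h

theorem exists_mem_witnesses_zero [Finite ι]
    (hD : ∀ s < t, ∀ A, PickedAt rule ω s A → Related (A : Set (∀ i, Ω i)) B → ↑A ∈ D)
    {L : List (Layer Ω)} (hL : L ∈ witnesses 𝒜 D B ω.2 (counts rule ω t)) :
    ∃ L' ∈ witnesses 𝒜 D B ω.2 0, ∀ i ∈ vbl B, usage L' i = usage L i + counts rule ω t i := by
  induction t generalizing L with
  | zero => exact ⟨L, hL, fun _ _ => rfl⟩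
  | succ t ih =>
    replace ih := @ih fun s hs => hD s (hs.trans t.lt_succ_self)
    obtain h | ⟨A, h⟩ := stoppedAt_or_exists_pickedAt rule ω t
    · rw [h.counts_succ] at hL ⊢
      exact ih hL
    · rw [h.counts_succ] at hL ⊢
      have hAD : MeetsLayer (A : Set (∀ i, Ω i)) {B} → ↑A ∈ D := fun ⟨C, hC, hAC⟩ =>
        hD t t.lt_succ_self A h (Finset.mem_singleton.1 hC ▸ hAC)
      obtain ⟨L', hL', husage⟩ := ih
        ⟨hL.1.graft A.2 hAD, hL.2.graft (assignment_eq_read rule ω t ▸ h.mem)⟩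
      refine ⟨L', hL', fun i hi => ?_⟩
      rw [husage i hi, usage_graft_apply (layerVbl_singleton.symm ▸ hi), Pi.add_apply, add_assoc,
        add_comm (Set.indicator _ _ _)]

/-- The witness is built from the first time at which `B` is true: since `B` has not been resampled
before, only its proper neighbors can occur directly below it. -/
theorem witnesses_nonempty_of_exists_mem [Finite ι] (h : ∃ t, assignment rule ω t ∈ B) :
    (witnesses 𝒜 (nbhd 𝒜 B) B ω.2 0).Nonempty := by
  classical
  have hne : ∀ s < Nat.find h, ∀ A, PickedAt rule ω s A → (A : Set (∀ i, Ω i)) ≠ B :=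
    fun s hs A hA hAB => Nat.find_min h hs (hAB ▸ hA.mem)
  obtain ⟨L, hL, -⟩ := exists_mem_witnesses_zero
    (fun s hs A hA hAB => mem_nbhd.2 ⟨A.2, hne s hs A hA, hAB.resolve_left (hne s hs A hA)⟩)
    (nil_mem_witnesses (Nat.find_spec h))
  exact ⟨L, hL⟩

theorem PickedAt.exists_mem_witnesses [Finite ι] (h : PickedAt rule ω t A) :
    ∃ L ∈ witnesses 𝒜 (closedNbhd 𝒜 {↑A}) A ω.2 0,
      ∀ i ∈ vbl (A : Set (∀ i, Ω i)), usage L i = counts rule ω t i := by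
  obtain ⟨L, hL, husage⟩ := exists_mem_witnesses_zero (D := closedNbhd 𝒜 {↑A})
    (fun s _ C _ hCA => MeetsLayer.mem_closedNbhd ⟨A, Finset.mem_singleton_self _, hCA⟩ C.2)
    (nil_mem_witnesses h.mem)
  exact ⟨L, hL, fun i hi => by simpa [usage] using husage i hi⟩

/-- Different resamplings of `A` have different witnesses, since they use different numbers of draws
of a variable of `A`. -/
theorem finite_pickedAt [Finite ι] (hA : (vbl (A : Set (∀ i, Ω i))).Nonempty)
    (hfin : (witnesses 𝒜 (closedNbhd 𝒜 {↑A}) A ω.2 0).Finite) :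
    {t | PickedAt rule ω t A}.Finite := by
  obtain ⟨i, hi⟩ := hA
  have himage : (fun t => counts rule ω t i) '' {t | PickedAt rule ω t A} ⊆
      (fun L => usage L i) '' witnesses 𝒜 (closedNbhd 𝒜 {↑A}) A ω.2 0 := by
    rintro _ ⟨t, ht, rfl⟩
    obtain ⟨L, hL, husage⟩ := PickedAt.exists_mem_witnesses ht
    exact ⟨L, hL, husage i hi⟩
  have hinj : StrictMonoOn (fun t => counts rule ω t i) {t | PickedAt rule ω t A} :=
    fun _ hs _ _ hst => PickedAt.counts_lt hs hi hst
  exact ((hfin.image _).subset himage).of_finite_image hinj.injOn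

theorem exists_stoppedAt (h : ∀ A, {t | PickedAt rule ω t A}.Finite) :
    ∃ t, StoppedAt rule ω t := by
  have hfin : {t | ∃ A, PickedAt rule ω t A}.Finite := by
    simpa only [Set.ofPred_exists] using Set.finite_iUnion h
  obtain ⟨t, ht⟩ := hfin.exists_notMem
  exact ⟨t, (stoppedAt_or_exists_pickedAt rule ω t).resolve_right ht⟩

theorem isSome_output_iff : (output rule ω).isSome ↔ ∃ t, StoppedAt rule ω t := by
  unfold output
  split_ifs with h <;> simp [h]

theorem exists_assignment_eq_of_mem_output {a : ∀ i, Ω i} (ha : a ∈ output rule ω) :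
    ∃ t, assignment rule ω t = a := by
  unfold output at ha
  split_ifs at ha with h
  · exact ⟨_, Option.mem_some_iff.1 ha⟩
  · simp at ha

end Run

section RunProbability

variable {ι : Type*} [Fintype ι] {Ω : ι → Type*} [∀ i, MeasurableSpace (Ω i)]
  {μ : ∀ i, Measure (Ω i)} [∀ i, IsProbabilityMeasure (μ i)] {𝒜 : Layer Ω}
  {z : Set (∀ i, Ω i) → ℝ≥0} {Seed : Type*} [MeasurableSpace Seed] {P : Measure (Sample Ω Seed)}

theorem LocalLemmaCondition.ae_exists_stoppedAt (hz : LocalLemmaCondition μ 𝒜 z)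
    (h𝒜 : ∀ A ∈ 𝒜, MeasurableSet A) (rule : SelectionRule 𝒜 Seed)
    (hP : MeasurePreserving Prod.snd P (tableMeasure μ)) :
    ∀ᵐ ω ∂P, ∃ t, StoppedAt rule ω t := by
  have hfin : ∀ A : 𝒜, ∀ᵐ ω ∂P, {t | PickedAt rule ω t A}.Finite := fun A => by
    have hwit := hz.ae_finite_witnesses h𝒜 (h𝒜 A A.2)
      (closedNbhd_subset (Finset.singleton_subset_iff.2 A.2)) 0
    filter_upwards [hP.quasiMeasurePreserving.ae hwit] with ω hω
    obtain hnone | ⟨t, ht⟩ := {t | PickedAt rule ω t A}.eq_empty_or_nonempty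
    · exact hnone ▸ Set.finite_empty
    · exact finite_pickedAt (hz.vbl_nonempty A.2 ⟨_, PickedAt.mem ht⟩) hω
  filter_upwards [ae_all_iff.2 hfin] with ω hω
  exact exists_stoppedAt hω

theorem LocalLemmaCondition.measure_exists_assignment_mem_le (hz : LocalLemmaCondition μ 𝒜 z)
    (h𝒜 : ∀ A ∈ 𝒜, MeasurableSet A) (rule : SelectionRule 𝒜 Seed)
    (hP : MeasurePreserving Prod.snd P (tableMeasure μ)) {B : Set (∀ i, Ω i)}
    (hB : MeasurableSet B) :
    P {ω | ∃ t, assignment rule ω t ∈ B} ≤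
      Measure.pi μ B * ∏ C ∈ nbhd 𝒜 B, (1 + z C : ℝ≥0∞) :=
  calc P {ω | ∃ t, assignment rule ω t ∈ B}
      ≤ P (Prod.snd ⁻¹' {T | (witnesses 𝒜 (nbhd 𝒜 B) B T 0).Nonempty}) :=
        measure_mono fun _ => witnesses_nonempty_of_exists_mem
    _ ≤ P.map Prod.snd {T | (witnesses 𝒜 (nbhd 𝒜 B) B T 0).Nonempty} :=
        Measure.le_map_apply hP.aemeasurable _
    _ = tableMeasure μ {T | (witnesses 𝒜 (nbhd 𝒜 B) B T 0).Nonempty} := by rw [hP.map_eq]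
    _ ≤ _ := hz.measure_witnesses_nonempty_le h𝒜 hB nbhd_subset 0

end RunProbability

section Odds

/-- The odds `p / (1 - p)` of a probability `p`. They are only meaningful for `0 ≤ p < 1`. -/
def odds (p : ℝ) : ℝ≥0 :=
  (p / (1 - p)).toNNReal

theorem coe_odds {p : ℝ} (hp : p ∈ Set.Ico (0 : ℝ) 1) : (odds p : ℝ) = p / (1 - p) :=
  Real.coe_toNNReal _ (div_nonneg hp.1 (sub_nonneg.2 hp.2.le))

theorem one_add_odds {p : ℝ} (hp : p ∈ Set.Ico (0 : ℝ) 1) : (1 + odds p : ℝ) = (1 - p)⁻¹ := by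
  have hne : 1 - p ≠ 0 := (sub_pos.2 hp.2).ne'
  rw [coe_odds hp]
  field_simp
  ring

variable {ι : Type*} {Ω : ι → Type*} {𝒜 : Layer Ω} {x : Set (∀ i, Ω i) → ℝ}

theorem prod_one_add_odds {s : Finset (Set (∀ i, Ω i))} (hx : ∀ A ∈ s, x A ∈ Set.Ico (0 : ℝ) 1) :
    (∏ C ∈ s, (1 + odds (x C) : ℝ≥0∞)).toReal = (∏ C ∈ s, (1 - x C))⁻¹ := by
  rw [ENNReal.toReal_prod, ← Finset.prod_inv_distrib]
  refine Finset.prod_congr rfl fun C hC => ?_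
  rw [← one_add_odds (hx C hC)]
  norm_cast

variable [Fintype ι] [∀ i, MeasurableSpace (Ω i)] {μ : ∀ i, Measure (Ω i)}
  [∀ i, IsProbabilityMeasure (μ i)]

theorem localLemmaCondition_odds (hx : ∀ A ∈ 𝒜, x A ∈ Set.Ico (0 : ℝ) 1)
    (hLLL : ∀ A ∈ 𝒜, (Measure.pi μ).real A ≤ x A * ∏ C ∈ nbhd 𝒜 A, (1 - x C)) :
    LocalLemmaCondition μ 𝒜 fun A => odds (x A) := by
  classical
  intro A hA
  have hpos : ∀ C ∈ 𝒜, 0 < 1 - x C := fun C hC => sub_pos.2 (hx C hC).2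
  have hprod : 0 < ∏ C ∈ nbhd 𝒜 A, (1 - x C) := Finset.prod_pos fun C hC => hpos C (nbhd_subset hC)
  have hnbhd : insert A (nbhd 𝒜 A) ⊆ 𝒜 := Finset.insert_subset hA nbhd_subset
  have hfin : ∏ C ∈ insert A (nbhd 𝒜 A), (1 + odds (x C) : ℝ≥0∞) ≠ ⊤ :=
    (ENNReal.prod_lt_top fun C _ => by simp).ne
  rw [← ENNReal.toReal_le_toReal (ENNReal.mul_ne_top (measure_ne_top _ _) hfin)
    ENNReal.coe_ne_top, ENNReal.toReal_mul, prod_one_add_odds fun C hC => hx C (hnbhd hC),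
    Finset.prod_insert fun h => (mem_nbhd.1 h).2.1 rfl, ENNReal.coe_toReal, coe_odds (hx A hA),
    ← div_eq_mul_inv, div_le_div_iff₀ (mul_pos (hpos A hA) hprod) (hpos A hA)]
  calc (Measure.pi μ).real A * (1 - x A)
      ≤ x A * (∏ C ∈ nbhd 𝒜 A, (1 - x C)) * (1 - x A) :=
        mul_le_mul_of_nonneg_right (hLLL A hA) (hpos A hA).le
    _ = x A * ((1 - x A) * ∏ C ∈ nbhd 𝒜 A, (1 - x C)) := by ring

variable {Seed : Type*} [MeasurableSpace Seed] {P : Measure (Sample Ω Seed)}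

theorem measureReal_exists_assignment_mem_le (h𝒜 : ∀ A ∈ 𝒜, MeasurableSet A)
    (hx : ∀ A ∈ 𝒜, x A ∈ Set.Ico (0 : ℝ) 1)
    (hLLL : ∀ A ∈ 𝒜, (Measure.pi μ).real A ≤ x A * ∏ C ∈ nbhd 𝒜 A, (1 - x C))
    (rule : SelectionRule 𝒜 Seed) (hP : MeasurePreserving Prod.snd P (tableMeasure μ))
    {B : Set (∀ i, Ω i)} (hB : MeasurableSet B) :
    P.real {ω | ∃ t, assignment rule ω t ∈ B} ≤
      (Measure.pi μ).real B * (∏ C ∈ nbhd 𝒜 B, (1 - x C))⁻¹ := by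
  have hfin : Measure.pi μ B * ∏ C ∈ nbhd 𝒜 B, (1 + odds (x C) : ℝ≥0∞) ≠ ⊤ :=
    ENNReal.mul_ne_top (measure_ne_top _ _) (ENNReal.prod_lt_top fun C _ => by simp).ne
  rw [← prod_one_add_odds fun C hC => hx C (nbhd_subset hC), measureReal_def, measureReal_def,
    ← ENNReal.toReal_mul]
  exact ENNReal.toReal_mono hfin
    ((localLemmaCondition_odds hx hLLL).measure_exists_assignment_mem_le h𝒜 rule hP hB)

end Odds

end

end MoserTardos

open MoserTardos in
/-- The rule may even foresee the draws: under `P`, its random bits can be correlated with all of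
them in an arbitrary way. -/
theorem theorem2p2_general {ι : Type*} [Fintype ι] {Ω : ι → Type*} [∀ i, MeasurableSpace (Ω i)]
    (μ : ∀ i, Measure (Ω i)) [∀ i, IsProbabilityMeasure (μ i)]
    (𝒜 : Finset (Set (∀ i, Ω i))) (h𝒜 : ∀ A ∈ 𝒜, MeasurableSet A)
    (x : Set (∀ i, Ω i) → ℝ) (hx : ∀ A ∈ 𝒜, x A ∈ Set.Ico (0 : ℝ) 1)
    (hLLL : ∀ A ∈ 𝒜, (Measure.pi μ).real A ≤ x A * ∏ C ∈ nbhd 𝒜 A, (1 - x C))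
    {Seed : Type*} [MeasurableSpace Seed] (P : Measure (Sample Ω Seed))
    (hP : MeasurePreserving Prod.snd P (Measure.infinitePi fun p : ι × ℕ => μ p.1))
    (rule : SelectionRule 𝒜 Seed) :
    (∀ᵐ ω ∂P, (output rule ω).isSome) ∧
    ∀ B : Set (∀ i, Ω i), MeasurableSet B →
      P.real {ω | ∃ t, assignment rule ω t ∈ B} ≤
        (Measure.pi μ).real B * (∏ C ∈ nbhd 𝒜 B, (1 - x C))⁻¹ ∧
      P.real {ω | ∃ a ∈ output rule ω, a ∈ B} ≤
        (Measure.pi μ).real B * (∏ C ∈ nbhd 𝒜 B, (1 - x C))⁻¹ := by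
  have hz := localLemmaCondition_odds hx hLLL
  refine ⟨?_, fun B hB => ?_⟩
  · simpa only [isSome_output_iff] using hz.ae_exists_stoppedAt h𝒜 rule hP
  · have hbound := measureReal_exists_assignment_mem_le h𝒜 hx hLLL rule hP hB
    have : IsFiniteMeasure (P.map Prod.snd) := hP.map_eq ▸ inferInstance
    have : IsFiniteMeasure P := Measure.isFiniteMeasure_of_map hP.aemeasurable
    have hsub : {ω | ∃ a ∈ output rule ω, a ∈ B} ⊆ {ω | ∃ t, assignment rule ω t ∈ B} := by
      rintro ω ⟨a, ha, haB⟩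
      obtain ⟨t, rfl⟩ := exists_assignment_eq_of_mem_output ha
      exact ⟨t, haB⟩
    exact ⟨hbound, (measureReal_mono hsub).trans hbound⟩

theorem theorem2p2 {ι : Type*} [Fintype ι] {Ω : ι → Type*} [∀ i, MeasurableSpace (Ω i)]
    (μ : ∀ i, Measure (Ω i)) [∀ i, IsProbabilityMeasure (μ i)]
    (𝒜 : Finset (Set (∀ i, Ω i))) (h𝒜 : ∀ A ∈ 𝒜, MeasurableSet A)
    (x : Set (∀ i, Ω i) → ℝ) (hx : ∀ A ∈ 𝒜, x A ∈ Set.Ioo (0 : ℝ) 1)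
    (hLLL : ∀ A ∈ 𝒜,
      (Measure.pi μ).real A ≤ x A * ∏ C ∈ MoserTardos.nbhd 𝒜 A, (1 - x C))
    {Seed : Type*} [MeasurableSpace Seed] (ν : Measure Seed) [IsProbabilityMeasure ν]
    (rule : MoserTardos.SelectionRule 𝒜 Seed) :
    (∀ᵐ ω ∂(MoserTardos.runMeasure μ ν), (MoserTardos.output rule ω).isSome) ∧
    ∀ B : Set (∀ i, Ω i), MeasurableSet B →
      (MoserTardos.runMeasure μ ν).real {ω | ∃ t, MoserTardos.assignment rule ω t ∈ B} ≤
        (Measure.pi μ).real B * (∏ C ∈ MoserTardos.nbhd 𝒜 B, (1 - x C))⁻¹ ∧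
      (MoserTardos.runMeasure μ ν).real {ω | ∃ a ∈ MoserTardos.output rule ω, a ∈ B} ≤
        (Measure.pi μ).real B * (∏ C ∈ MoserTardos.nbhd 𝒜 B, (1 - x C))⁻¹ :=
  theorem2p2_general μ 𝒜 h𝒜 x (fun A hA => Set.Ioo_subset_Ico_self (hx A hA)) hLLL
    (MoserTardos.runMeasure μ ν) measurePreserving_snd rule
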